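/- All graphs are finite and simple. A cograph is a graph with no induced path on four vertices. A graph $G=(V,E)$ is called partitionable if $V$ is the union of two disjoint, possibly empty, sets $A$ and $B$ such that $A$ induces a disjoint union of cliques (vertex-disjoint cliques with no edges between them) and $B$ induces a triangle-free graph. Write $K_n$, $P_n$, $C_n$ for the complete graph, the path and the cycle on $n$ vertices, $G\cup H$ for the disjoint union, $2G=G\cup G$, and $G\oplus H$ for the join (the disjoint union together with all edges between $G$ and $H$). Let \begin{align*} H_1&=2K_1\oplus 2K_1\oplus 2K_1\oplus K_1, & H_2&=P_3\oplus K_1\oplus 2K_2,\\ H_3&=2K_1\oplus (K_2\cup K_1)\oplus (K_2\cup K_1), & H_4&=P_3\oplus (K_2\cup P_3),\\ H_5&=(K_2\cup K_1)\oplus K_1\oplus 2K_2, & H_6&=(K_2\cup K_1)\oplus (K_3\cup P_3),\\ H_7&=(K_2\cup K_1)\oplus (K_2\cup (P_3\oplus K_1)), & H_8&=(K_2\cup K_1)\oplus (K_2\cup (K_1\oplus (K_2\cup K_1))),\\ H_9&=K_1\oplus (K_3\cup (C_4\oplus K_1)), & H_{10}&=K_1\oplus (K_3\cup (K_1\oplus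 (P_3\cup K_2))),\\ H_{11}&=K_1\oplus (K_3\cup (K_2\oplus 2K_2)), & H_{12}&=K_1\oplus (K_3\cup ((K_2\cup K_1)\oplus (K_2\cup K_1))),\\ H_{13}&=K_2\oplus (P_3\cup 2K_3), & H_{14}&=K_2\oplus (K_3\cup (P_3\oplus K_1)),\\ H_{15}&=K_2\oplus (K_3\cup (K_1\oplus (K_1\cup K_2))), & H_{16}&=(K_3\cup K_2)\oplus (K_3\cup K_1),\\ H_{17}&=K_3\oplus 2K_3. && \end{align*} Theorem. A cograph $G$ is partitionable if and only if none of the graphs $H_1,\dots,H_{17}$ is isomorphic to an induced subgraph of $G$. -/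

import Mathlib

open scoped SimpleGraph

namespace CographPartition

section Notions

variable {V W : Type*}

/-- `G` is a disjoint union of cliques: its vertex set is partitioned into classes such that two
distinct vertices are adjacent exactly when they lie in the same class. -/
def IsDisjointUnionOfCliques (G : SimpleGraph V) : Prop :=
  ∃ r : Setoid V, ∀ u v : V, G.Adj u v ↔ u ≠ v ∧ r u v

/-- `G` is partitionable: its vertex set splits into two (possibly empty) parts `A` and `B` such
that `A` induces a disjoint union of cliques and `B` induces a triangle-free graph. -/
def IsPartitionable (G : SimpleGraph V) : Prop :=
  ∃ A B : Set V, A ∪ B = Set.univ ∧ Disjoint A B ∧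
    IsDisjointUnionOfCliques (G.induce A) ∧ (G.induce B).CliqueFree 3

/-- A cograph: a graph without the path on four vertices as an induced subgraph. -/
def IsCograph (G : SimpleGraph V) : Prop :=
  ¬ SimpleGraph.pathGraph 4 ⊴ G

/-- The join of two graphs: their disjoint union together with all edges between them. -/
def join (G : SimpleGraph V) (H : SimpleGraph W) : SimpleGraph (V ⊕ W) :=
  (G ⊕g H) ⊔ completeBipartiteGraph V W

/-- The disjoint union of two copies of `G`. -/
def two (G : SimpleGraph V) : SimpleGraph (V ⊕ V) :=
  G ⊕g G

end Notions

/-- The complete graph on `n` vertices. -/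
def K (n : ℕ) : SimpleGraph (Fin n) := SimpleGraph.completeGraph (Fin n)

/-- The path on `n` vertices. -/
def P (n : ℕ) : SimpleGraph (Fin n) := SimpleGraph.pathGraph n

/-- The cycle on `n` vertices. -/
def C (n : ℕ) : SimpleGraph (Fin n) := SimpleGraph.cycleGraph n

/-! The seventeen forbidden graphs (`⊕g` is the disjoint union). -/

def H1 := join (join (join (two (K 1)) (two (K 1))) (two (K 1))) (K 1)

def H2 := join (join (P 3) (K 1)) (two (K 2))

def H3 := join (join (two (K 1)) (K 2 ⊕g K 1)) (K 2 ⊕g K 1)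

def H4 := join (P 3) (K 2 ⊕g P 3)

def H5 := join (join (K 2 ⊕g K 1) (K 1)) (two (K 2))

def H6 := join (K 2 ⊕g K 1) (K 3 ⊕g P 3)

def H7 := join (K 2 ⊕g K 1) (K 2 ⊕g join (P 3) (K 1))

def H8 := join (K 2 ⊕g K 1) (K 2 ⊕g join (K 1) (K 2 ⊕g K 1))

def H9 := join (K 1) (K 3 ⊕g join (C 4) (K 1))

def H10 := join (K 1) (K 3 ⊕g join (K 1) (P 3 ⊕g K 2))

def H11 := join (K 1) (K 3 ⊕g join (K 2) (two (K 2)))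

def H12 := join (K 1) (K 3 ⊕g join (K 2 ⊕g K 1) (K 2 ⊕g K 1))

def H13 := join (K 2) (P 3 ⊕g two (K 3))

def H14 := join (K 2) (K 3 ⊕g join (P 3) (K 1))

def H15 := join (K 2) (K 3 ⊕g join (K 1) (K 1 ⊕g K 2))

def H16 := join (K 3 ⊕g K 2) (K 3 ⊕g K 1)

def H17 := join (K 3) (two (K 3))

end CographPartition

namespace CographPartition

/-! A cograph with at least two vertices is a disjoint union or a join (Seinsche), so every nonempty
finite cograph comes from a cotree (`exists_iso_of_isCograph`). Record for a graph which pairs of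
levels (empty, clique, cluster; empty, independent, triangle-free) its partitions attain. This
table, the state, is computed for a union or join from the tables of its sides
(`hasLevels_combineGraphs`). Once all nonpartitionable graphs are merged into one empty state, the
states that arise are few.

For each state a finite list of graphs is given, the list of the empty state being the forbidden
graphs. By `critical_closed`, a finite check, combining members of two nonempty states yields a
graph containing a listed graph of the resulting state. Induction on the cotree (`exists_critical`)
then shows that every cotree contains a listed graph of its own state, so a nonpartitionable one
contains a forbidden graph. The converse holds because partitionability is hereditary and the
forbidden graphs have empty state. -/

/-- Cotrees: expressions built from single vertices by disjoint unions (`node false`) and joins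
(`node true`). -/
inductive Cotree : Type
  | leaf : Cotree
  | node : Bool → Cotree → Cotree → Cotree

/-! ### States of cotrees and the finite computation. -/

namespace Cotree

local infixl:65 "∪ₜ" => Cotree.node false
local infixl:70 "⊕ₜ" => Cotree.node true
local notation "K₁" => Cotree.leaf
local notation "K₂" => Cotree.node true Cotree.leaf Cotree.leaf
local notation "K₃" => Cotree.node true (Cotree.node true Cotree.leaf Cotree.leaf) Cotree.leaf
local notation "P₃" => Cotree.node true Cotree.leaf (Cotree.node false Cotree.leaf Cotree.leaf)
local notation "C₄" => Cotree.node true (Cotree.node false K₁ K₁) (Cotree.node false K₁ K₁)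

/-- The levels at which the two sides of a union (`false`) or join (`true`) can meet `A` so that
`A` has level `a`: empty (`0`), a clique (`1`) or a disjoint union of cliques (`2`). -/
def clusterSplits : Bool → Fin 3 → List (Fin 3 × Fin 3)
  | _, 0 => [(0, 0)]
  | false, 1 => [(0, 1), (1, 0)]
  | true, 1 => [(1, 1)]
  | false, 2 => [(2, 2)]
  | true, 2 => [(0, 2), (2, 0), (1, 1)]

/-- The levels at which the two sides of a union (`false`) or join (`true`) can meet `B` so that
`B` has level `b`: empty (`0`), independent (`1`) or triangle-free (`2`). -/
def triangleFreeSplits : Bool → Fin 3 → List (Fin 3 × Fin 3)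
  | _, 0 => [(0, 0)]
  | false, 1 => [(1, 1)]
  | true, 1 => [(0, 1), (1, 0)]
  | false, 2 => [(2, 2)]
  | true, 2 => [(0, 2), (2, 0), (1, 1)]

/-- All pairs of levels. -/
def levels : List (Fin 3 × Fin 3) :=
  [(0, 0), (0, 1), (0, 2), (1, 0), (1, 1), (1, 2), (2, 0), (2, 1), (2, 2)]

/-- The pairs of levels attained by a union or join, from those attained by its two sides. -/
def combine (c : Bool) (p q : List (Fin 3 × Fin 3)) : List (Fin 3 × Fin 3) :=
  levels.filter fun x => (clusterSplits c x.1).any fun a => (triangleFreeSplits c x.2).any fun b =>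
    p.contains (a.1, b.1) && q.contains (a.2, b.2)

/-- The pairs of levels attained by some partition of the graph of a cotree, with all
nonpartitionable cotrees identified. -/
def state : Cotree → List (Fin 3 × Fin 3)
  | leaf => levels.tail
  | node c s t =>
    bif (combine c (state s) (state t)).contains (2, 2) then combine c (state s) (state t) else []

/-- The ways to write a cotree, up to isomorphism, as a union (`false`) or join (`true`). -/
def splits (c : Bool) : Cotree → List (Cotree × Cotree)
  | leaf => []
  | node d s t =>
    bif c == d then
      -- Either a child stays whole on one side, or both children are split and their pieces are
      -- paired. Reversed splits need no clause of their own in the recursive cases, since the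
      -- splits of a child already occur in both orders.
      (s, t) :: (t, s) ::
        (((splits c s).flatMap fun x =>
          (node c x.1 t, x.2) :: (x.1, node c x.2 t) ::
            (splits c t).map fun y => (node c x.1 y.1, node c x.2 y.2)) ++
        (splits c t).flatMap fun y => [(node c s y.1, y.2), (y.1, node c s y.2)])
    else []

/-- A test for the graph of the first cotree being an induced subgraph of that of the second. -/
def embeds (F : Cotree) : Cotree → Bool
  | leaf => match F with
    | leaf => true
    | node _ _ _ => false
  | node c s t => embeds F s || embeds F t ||
      (splits c F).any fun x => embeds x.1 s && embeds x.2 t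

/-- The forbidden graphs. -/
def forbidden : List Cotree :=
  [(K₁ ∪ₜ K₁) ⊕ₜ (K₁ ∪ₜ K₁) ⊕ₜ (K₁ ∪ₜ K₁) ⊕ₜ K₁,
   P₃ ⊕ₜ K₁ ⊕ₜ (K₂ ∪ₜ K₂),
   (K₁ ∪ₜ K₁) ⊕ₜ (K₂ ∪ₜ K₁) ⊕ₜ (K₂ ∪ₜ K₁),
   P₃ ⊕ₜ (K₂ ∪ₜ P₃),
   (K₂ ∪ₜ K₁) ⊕ₜ K₁ ⊕ₜ (K₂ ∪ₜ K₂),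
   (K₂ ∪ₜ K₁) ⊕ₜ (K₃ ∪ₜ P₃),
   (K₂ ∪ₜ K₁) ⊕ₜ (K₂ ∪ₜ P₃ ⊕ₜ K₁),
   (K₂ ∪ₜ K₁) ⊕ₜ (K₂ ∪ₜ K₁ ⊕ₜ (K₂ ∪ₜ K₁)),
   K₁ ⊕ₜ (K₃ ∪ₜ C₄ ⊕ₜ K₁),
   K₁ ⊕ₜ (K₃ ∪ₜ K₁ ⊕ₜ (P₃ ∪ₜ K₂)),
   K₁ ⊕ₜ (K₃ ∪ₜ K₂ ⊕ₜ (K₂ ∪ₜ K₂)),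
   K₁ ⊕ₜ (K₃ ∪ₜ (K₂ ∪ₜ K₁) ⊕ₜ (K₂ ∪ₜ K₁)),
   K₂ ⊕ₜ (P₃ ∪ₜ (K₃ ∪ₜ K₃)),
   K₂ ⊕ₜ (K₃ ∪ₜ P₃ ⊕ₜ K₁),
   K₂ ⊕ₜ (K₃ ∪ₜ K₁ ⊕ₜ (K₁ ∪ₜ K₂)),
   (K₃ ∪ₜ K₂) ⊕ₜ (K₃ ∪ₜ K₁),
   K₃ ⊕ₜ (K₃ ∪ₜ K₃)]

/-- The minimal partitionable cotrees of each state, grouped by state. -/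
def benign : List (List Cotree) :=
  [[K₁],
   [K₁ ∪ₜ K₁],
   [K₂],
   [K₁ ⊕ₜ (K₁ ∪ₜ K₁)],
   [K₂ ∪ₜ K₁],
   [K₃],
   [(K₁ ∪ₜ K₁) ⊕ₜ (K₁ ∪ₜ K₁), K₂ ∪ₜ (K₁ ⊕ₜ (K₁ ∪ₜ K₁))],
   [K₂ ⊕ₜ (K₁ ∪ₜ K₁), K₁ ⊕ₜ (K₂ ∪ₜ K₁)],
   [K₂ ∪ₜ K₂],
   [K₃ ∪ₜ K₁],
   [K₁ ⊕ₜ (K₁ ∪ₜ K₁) ⊕ₜ (K₁ ∪ₜ K₁), K₂ ⊕ₜ (K₂ ∪ₜ K₂), (K₂ ∪ₜ K₁) ⊕ₜ (K₂ ∪ₜ K₁),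
    K₁ ⊕ₜ (K₂ ∪ₜ (K₁ ⊕ₜ (K₁ ∪ₜ K₁)))],
   [K₁ ⊕ₜ (K₂ ∪ₜ K₂), (K₂ ∪ₜ K₁) ⊕ₜ (K₁ ∪ₜ K₁), K₂ ∪ₜ (K₂ ⊕ₜ (K₁ ∪ₜ K₁)), K₃ ∪ₜ (K₁ ⊕ₜ (K₁ ∪ₜ K₁)),
    K₂ ∪ₜ (K₁ ⊕ₜ (K₂ ∪ₜ K₁))],
   [K₂ ∪ₜ K₃],
   [(K₁ ∪ₜ K₁) ⊕ₜ (K₁ ∪ₜ K₁) ⊕ₜ (K₁ ∪ₜ K₁), K₁ ⊕ₜ (K₂ ∪ₜ K₂) ⊕ₜ (K₁ ∪ₜ K₁), (K₂ ∪ₜ K₂) ⊕ₜ (K₂ ∪ₜ K₁),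
    (K₂ ∪ₜ (K₁ ⊕ₜ (K₁ ∪ₜ K₁))) ⊕ₜ (K₁ ∪ₜ K₁), K₁ ⊕ₜ (K₃ ∪ₜ (K₂ ⊕ₜ (K₁ ∪ₜ K₁))), K₂ ⊕ₜ (K₃ ∪ₜ K₃),
    K₃ ∪ₜ (K₁ ⊕ₜ (K₁ ∪ₜ K₁) ⊕ₜ (K₁ ∪ₜ K₁)), K₁ ⊕ₜ (K₃ ∪ₜ (K₁ ⊕ₜ (K₂ ∪ₜ K₁))), K₃ ∪ₜ (K₂ ⊕ₜ (K₂ ∪ₜ K₂)),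
    K₃ ∪ₜ ((K₂ ∪ₜ K₁) ⊕ₜ (K₂ ∪ₜ K₁)), K₃ ∪ₜ (K₁ ⊕ₜ (K₂ ∪ₜ (K₁ ⊕ₜ (K₁ ∪ₜ K₁)))),
    K₁ ⊕ₜ (K₃ ∪ₜ K₃ ∪ₜ (K₁ ⊕ₜ (K₁ ∪ₜ K₁)))],
   [(K₂ ∪ₜ K₂) ⊕ₜ (K₁ ∪ₜ K₁), K₃ ∪ₜ (K₂ ⊕ₜ (K₁ ∪ₜ K₁)), K₁ ⊕ₜ (K₃ ∪ₜ K₃), K₃ ∪ₜ (K₁ ⊕ₜ (K₂ ∪ₜ K₁)),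
    K₃ ∪ₜ K₃ ∪ₜ (K₁ ⊕ₜ (K₁ ∪ₜ K₁))],
   [K₃ ∪ₜ K₃]]

/-- The forbidden graphs and the minimal partitionable cotrees, grouped by state. -/
def critical : List (List Cotree) :=
  forbidden :: benign

theorem state_forbidden : (forbidden.all fun F => state F == []) = true := by
  decide +kernel

/-- The head of a group can stand for the state of the whole group. No group is empty, so the
default `leaf` is never used. -/
theorem state_benign : (benign.all fun C => C.all fun F =>
    state F == state (C.headD leaf) && state F != []) = true := by
  decide +kernel

/-- The induction step in finite form. The state of a node depends only on the states of its
children, so heads suffice to find the target group `D`. Forbidden operands are left out: a node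
over one already contains it. -/
theorem critical_closed : (benign.all fun C => benign.all fun C' => [false, true].all fun c =>
    critical.any fun D =>
      state (D.headD leaf) == state (node c (C.headD leaf) (C'.headD leaf)) &&
        C.all fun F => C'.all fun F' => D.any fun E => embeds E (node c F F')) = true := by
  decide +kernel

end Cotree

/-! ### Induced containment under unions and joins. -/

section Operations

variable {V W X Y : Type*}

/-- The disjoint union (`false`) or join (`true`) of two graphs. -/
def combineGraphs (c : Bool) (G : SimpleGraph V) (H : SimpleGraph W) : SimpleGraph (V ⊕ W) :=
  bif c then join G H else G ⊕g H

@[simp]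
theorem combineGraphs_inl_inl (c : Bool) (G : SimpleGraph V) (H : SimpleGraph W) (x y : V) :
    (combineGraphs c G H).Adj (.inl x) (.inl y) ↔ G.Adj x y := by
  cases c <;> simp [combineGraphs, join]

@[simp]
theorem combineGraphs_inr_inr (c : Bool) (G : SimpleGraph V) (H : SimpleGraph W) (x y : W) :
    (combineGraphs c G H).Adj (.inr x) (.inr y) ↔ H.Adj x y := by
  cases c <;> simp [combineGraphs, join]

@[simp]
theorem combineGraphs_inl_inr (c : Bool) (G : SimpleGraph V) (H : SimpleGraph W) (x : V) (y : W) :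
    (combineGraphs c G H).Adj (.inl x) (.inr y) ↔ c = true := by
  cases c <;> simp [combineGraphs, join]

@[simp]
theorem combineGraphs_inr_inl (c : Bool) (G : SimpleGraph V) (H : SimpleGraph W) (x : W) (y : V) :
    (combineGraphs c G H).Adj (.inr x) (.inl y) ↔ c = true := by
  cases c <;> simp [combineGraphs, join]

variable {G : SimpleGraph V} {H : SimpleGraph W} {G' : SimpleGraph X} {H' : SimpleGraph Y}

theorem isIndContained_combineGraphs (c : Bool) (hG : G ⊴ G') (hH : H ⊴ H') :
    combineGraphs c G H ⊴ combineGraphs c G' H' := by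
  obtain ⟨f⟩ := hG
  obtain ⟨g⟩ := hH
  refine ⟨⟨f.toEmbedding.sumMap g.toEmbedding, ?_⟩⟩
  rintro (x | x) (y | y) <;> simp

theorem isIndContained_combineGraphs_left (c : Bool) (G : SimpleGraph V) (H : SimpleGraph W) :
    G ⊴ combineGraphs c G H :=
  ⟨⟨.inl, by simp⟩⟩

theorem isIndContained_combineGraphs_right (c : Bool) (G : SimpleGraph V) (H : SimpleGraph W) :
    H ⊴ combineGraphs c G H :=
  ⟨⟨.inr, by simp⟩⟩

/-- This and the following rearrangements are isomorphisms; only containment is kept, which is all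
that the soundness of `splits` requires. -/
theorem isIndContained_combineGraphs_comm (c : Bool) (G : SimpleGraph V) (H : SimpleGraph W) :
    combineGraphs c G H ⊴ combineGraphs c H G := by
  refine ⟨⟨(Equiv.sumComm V W).toEmbedding, ?_⟩⟩
  rintro (x | x) (y | y) <;> simp

theorem isIndContained_combineGraphs_assoc (c : Bool) (G : SimpleGraph V) (H : SimpleGraph W)
    (G' : SimpleGraph X) :
    combineGraphs c (combineGraphs c G H) G' ⊴ combineGraphs c G (combineGraphs c H G') := by
  refine ⟨⟨(Equiv.sumAssoc V W X).toEmbedding, ?_⟩⟩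
  rintro ((x | x) | x) ((y | y) | y) <;> simp

theorem isIndContained_combineGraphs_assoc_symm (c : Bool) (G : SimpleGraph V) (H : SimpleGraph W)
    (G' : SimpleGraph X) :
    combineGraphs c G (combineGraphs c H G') ⊴ combineGraphs c (combineGraphs c G H) G' := by
  refine ⟨⟨(Equiv.sumAssoc V W X).symm.toEmbedding, ?_⟩⟩
  rintro (x | x | x) (y | y | y) <;> simp

theorem isIndContained_combineGraphs_right_comm (c : Bool) (G : SimpleGraph V) (H : SimpleGraph W)
    (G' : SimpleGraph X) :
    combineGraphs c (combineGraphs c G H) G' ⊴ combineGraphs c (combineGraphs c G G') H :=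
  (isIndContained_combineGraphs_assoc c G H G').trans <|
    (isIndContained_combineGraphs c .rfl (isIndContained_combineGraphs_comm c H G')).trans <|
      isIndContained_combineGraphs_assoc_symm c G G' H

theorem isIndContained_combineGraphs_interchange (c : Bool) (G : SimpleGraph V) (H : SimpleGraph W)
    (G' : SimpleGraph X) (H' : SimpleGraph Y) :
    combineGraphs c (combineGraphs c G H) (combineGraphs c G' H') ⊴
      combineGraphs c (combineGraphs c G G') (combineGraphs c H H') := by
  refine ⟨⟨(Equiv.sumSumSumComm V W X Y).toEmbedding, ?_⟩⟩
  rintro ((x | x) | x | x) ((y | y) | y | y) <;> simp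

end Operations

/-! ### Levels of partitions and how they combine. -/

section Levels

variable {V W : Type*}

/-- `A` is empty (level `0`), a clique (level `1`), or induces no path on three vertices
(level `2`). -/
def ClusterLevel (G : SimpleGraph V) (A : V → Prop) : Fin 3 → Prop
  | 0 => ∀ x, ¬ A x
  | 1 => ∀ x y, A x → A y → x ≠ y → G.Adj x y
  | 2 => ∀ x y z, A x → A y → A z → G.Adj x y → G.Adj y z → x ≠ z → G.Adj x z

/-- `B` is empty (level `0`), independent (level `1`), or triangle-free (level `2`). -/
def TriangleFreeLevel (G : SimpleGraph V) (B : V → Prop) : Fin 3 → Prop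
  | 0 => ∀ x, ¬ B x
  | 1 => ∀ x y, B x → B y → ¬ G.Adj x y
  | 2 => ∀ x y z, B x → B y → B z → G.Adj x y → G.Adj y z → ¬ G.Adj x z

/-- `G` splits into parts of the given levels. -/
def HasLevels (G : SimpleGraph V) (x : Fin 3 × Fin 3) : Prop :=
  ∃ A : V → Prop, ClusterLevel G A x.1 ∧ TriangleFreeLevel G (fun v => ¬ A v) x.2

variable {G : SimpleGraph V} {H : SimpleGraph W}

/-- Every level is a universal condition on vertices, so a partition pulls back along an embedding.
-/
theorem HasLevels.of_isIndContained {x : Fin 3 × Fin 3} (h : HasLevels H x) (hGH : G ⊴ H) :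
    HasLevels G x := by
  obtain ⟨f⟩ := hGH
  obtain ⟨A, hA, hB⟩ := h
  obtain ⟨a, b⟩ := x
  refine ⟨fun v => A (f v), ?_, ?_⟩
  · fin_cases a
    · exact fun x => hA (f x)
    · exact fun x y hx hy hxy => f.map_adj_iff.1 (hA _ _ hx hy (f.injective.ne hxy))
    · exact fun x y z hx hy hz h1 h2 hxz => f.map_adj_iff.1
        (hA _ _ _ hx hy hz (f.map_adj_iff.2 h1) (f.map_adj_iff.2 h2) (f.injective.ne hxz))
  · fin_cases b
    · exact fun x => hB (f x)
    · exact fun x y hx hy h => hB _ _ hx hy (f.map_adj_iff.2 h)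
    · exact fun x y z hx hy hz h1 h2 h3 => hB _ _ _ hx hy hz (f.map_adj_iff.2 h1)
        (f.map_adj_iff.2 h2) (f.map_adj_iff.2 h3)

theorem clusterLevel_combineGraphs (c : Bool) (a : Fin 3) (A : V ⊕ W → Prop) :
    ClusterLevel (combineGraphs c G H) A a ↔ ∃ x ∈ Cotree.clusterSplits c a,
      ClusterLevel G (fun v => A (.inl v)) x.1 ∧ ClusterLevel H (fun v => A (.inr v)) x.2 := by
  fin_cases a <;> cases c
  · simp [ClusterLevel, Cotree.clusterSplits]
  · simp [ClusterLevel, Cotree.clusterSplits]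
  · simp [ClusterLevel, Cotree.clusterSplits]
    grind
  · simp [ClusterLevel, Cotree.clusterSplits]
  · simp [ClusterLevel, Cotree.clusterSplits]
  · simp only [Cotree.clusterSplits, List.mem_cons, List.not_mem_nil, or_false,
      exists_eq_or_imp, exists_eq_left]
    constructor
    · intro h
      -- In a join met by `A` on both sides, a vertex of one side is a common neighbour of any two
      -- vertices of the other, which forces both sides to be cliques.
      by_cases hV : ∃ v, A (.inl v)
      · by_cases hW : ∃ w, A (.inr w)
        · obtain ⟨v, hv⟩ := hV
          obtain ⟨w, hw⟩ := hW
          refine .inr (.inr ⟨fun x y hx hy hxy => ?_, fun x y hx hy hxy => ?_⟩)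
          · simpa using h (.inl x) (.inr w) (.inl y) hx hw hy (by simp) (by simp) (by simpa)
          · simpa using h (.inr x) (.inl v) (.inr y) hx hv hy (by simp) (by simp) (by simpa)
        · exact .inr (.inl ⟨fun x y z hx hy hz hxy hyz hxz => by
            simpa using h (.inl x) (.inl y) (.inl z) hx hy hz (by simpa) (by simpa) (by simpa),
            not_exists.1 hW⟩)
      · exact .inl ⟨not_exists.1 hV, fun x y z hx hy hz hxy hyz hxz => by
          simpa using h (.inr x) (.inr y) (.inr z) hx hy hz (by simpa) (by simpa) (by simpa)⟩
    · rintro (⟨h1, h2⟩ | ⟨h1, h2⟩ | ⟨h1, h2⟩) (x | x) (y | y) (z | z) <;>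
        simp_all [ClusterLevel] <;> grind

theorem triangleFreeLevel_combineGraphs (c : Bool) (b : Fin 3) (B : V ⊕ W → Prop) :
    TriangleFreeLevel (combineGraphs c G H) B b ↔ ∃ x ∈ Cotree.triangleFreeSplits c b,
      TriangleFreeLevel G (fun v => B (.inl v)) x.1 ∧
        TriangleFreeLevel H (fun v => B (.inr v)) x.2 := by
  fin_cases b <;> cases c
  · simp [TriangleFreeLevel, Cotree.triangleFreeSplits]
  · simp [TriangleFreeLevel, Cotree.triangleFreeSplits]
  · simp [TriangleFreeLevel, Cotree.triangleFreeSplits]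
  · simp [TriangleFreeLevel, Cotree.triangleFreeSplits]
    grind
  · simp [TriangleFreeLevel, Cotree.triangleFreeSplits]
  · simp only [Cotree.triangleFreeSplits, List.mem_cons, List.not_mem_nil, or_false,
      exists_eq_or_imp, exists_eq_left]
    constructor
    · intro h
      -- In a join met by `B` on both sides, a vertex of one side completes any edge of the other to
      -- a triangle, so both sides are independent.
      by_cases hV : ∃ v, B (.inl v)
      · by_cases hW : ∃ w, B (.inr w)
        · obtain ⟨v, hv⟩ := hV
          obtain ⟨w, hw⟩ := hW
          refine .inr (.inr ⟨fun x y hx hy hxy => ?_, fun x y hx hy hxy => ?_⟩)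
          · exact h (.inl x) (.inl y) (.inr w) hx hy hw (by simpa) (by simp) (by simp)
          · exact h (.inr x) (.inr y) (.inl v) hx hy hv (by simpa) (by simp) (by simp)
        · exact .inr (.inl ⟨fun x y z hx hy hz hxy hyz hxz =>
            h (.inl x) (.inl y) (.inl z) hx hy hz (by simpa) (by simpa) (by simpa),
            not_exists.1 hW⟩)
      · exact .inl ⟨not_exists.1 hV, fun x y z hx hy hz hxy hyz hxz =>
          h (.inr x) (.inr y) (.inr z) hx hy hz (by simpa) (by simpa) (by simpa)⟩
    · rintro (⟨h1, h2⟩ | ⟨h1, h2⟩ | ⟨h1, h2⟩) (x | x) (y | y) (z | z) <;>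
        simp_all [TriangleFreeLevel] <;> grind

/-- The levels of the two parts split independently, and partitions of the two sides glue freely. -/
theorem hasLevels_combineGraphs (c : Bool) (x : Fin 3 × Fin 3) :
    HasLevels (combineGraphs c G H) x ↔ ∃ a ∈ Cotree.clusterSplits c x.1,
      ∃ b ∈ Cotree.triangleFreeSplits c x.2, HasLevels G (a.1, b.1) ∧ HasLevels H (a.2, b.2) := by
  constructor
  · rintro ⟨A, hA, hB⟩
    obtain ⟨a, ha, ha1, ha2⟩ := (clusterLevel_combineGraphs c _ _).1 hA
    obtain ⟨b, hb, hb1, hb2⟩ := (triangleFreeLevel_combineGraphs c _ _).1 hB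
    exact ⟨a, ha, b, hb, ⟨_, ha1, hb1⟩, ⟨_, ha2, hb2⟩⟩
  · rintro ⟨a, ha, b, hb, ⟨A, hA, hB⟩, ⟨A', hA', hB'⟩⟩
    exact ⟨Sum.elim A A', (clusterLevel_combineGraphs c _ _).2 ⟨a, ha, hA, hA'⟩,
      (triangleFreeLevel_combineGraphs c _ _).2 ⟨b, hb, hB, hB'⟩⟩

theorem isPartitionable_iff_hasLevels (G : SimpleGraph V) :
    IsPartitionable G ↔ HasLevels G (2, 2) := by
  constructor
  · rintro ⟨A, B, hAB, -, ⟨r, hr⟩, hB⟩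
    refine ⟨fun v => v ∈ A, fun x y z hx hy hz hxy hyz hxz => ?_, fun x y z hx hy hz hxy hyz hxz => ?_⟩
    · have h1 := (hr ⟨x, hx⟩ ⟨y, hy⟩).1 (by simpa using hxy)
      have h2 := (hr ⟨y, hy⟩ ⟨z, hz⟩).1 (by simpa using hyz)
      simpa using (hr ⟨x, hx⟩ ⟨z, hz⟩).2 ⟨by simpa using hxz, r.trans h1.2 h2.2⟩
    · have hmem : ∀ v, v ∉ A → v ∈ B := fun v hv =>
        ((Set.ext_iff.1 hAB v).2 trivial).resolve_left hv
      classical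
      refine hB ({⟨x, hmem x hx⟩, ⟨y, hmem y hy⟩, ⟨z, hmem z hz⟩} : Finset B) ?_
      rw [SimpleGraph.is3Clique_triple_iff]
      exact ⟨hxy, hxz, hyz⟩
  · rintro ⟨A, hA, hB⟩
    refine ⟨{v | A v}, {v | ¬ A v}, Set.union_compl_self {v | A v}, disjoint_compl_right, ?_, ?_⟩
    -- Having no induced path on three vertices is exactly transitivity of "equal or adjacent".
    · refine ⟨⟨fun u v => u = v ∨ G.Adj u v, fun _ => .inl rfl, ?_, ?_⟩, fun u v => ?_⟩
      · rintro u v (rfl | h)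
        exacts [.inl rfl, .inr h.symm]
      · rintro u v w (rfl | h) (rfl | h')
        · exact .inl rfl
        · exact .inr h'
        · exact .inr h
        · by_cases huw : u = w
          · exact .inl huw
          · exact .inr (hA u v w u.2 v.2 w.2 h h' (fun h => huw (Subtype.ext h)))
      · change G.Adj u v ↔ u ≠ v ∧ (u = v ∨ G.Adj u v)
        have : u = v → ¬ G.Adj u v := by rintro rfl; exact G.irrefl
        tauto
    · classical
      intro s hs
      obtain ⟨a, b, c, hab, hac, hbc, rfl⟩ := SimpleGraph.is3Clique_iff.1 hs
      exact hB a b c a.2 b.2 c.2 hab hbc hac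

end Levels

/-! ### Decomposition of cographs into unions and joins. -/

section Seinsche

variable {V : Type*}

/-- A relation without the pattern of an induced path `a - b - c - d`. -/
def NoInducedPath (r : V → V → Prop) : Prop :=
  ∀ a b c d, r a b → r b c → r c d → a ≠ c → a ≠ d → b ≠ d → r a c ∨ r a d ∨ r b d

theorem IsCograph.noInducedPath {G : SimpleGraph V} (hG : IsCograph G) : NoInducedPath G.Adj := by
  intro a b c d hab hbc hcd hac hbd had
  by_contra! h
  refine hG ⟨⟨⟨![a, b, c, d], ?_⟩, ?_⟩⟩
  · have := hab.ne
    have := hbc.ne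
    have := hcd.ne
    intro i j hij
    fin_cases i <;> fin_cases j <;> simp_all
  · intro i j
    have := hab.symm
    have := hbc.symm
    have := hcd.symm
    obtain ⟨h1, h2, h3⟩ := id h
    rw [G.adj_comm] at h1 h2 h3
    change G.Adj (![a, b, c, d] i) (![a, b, c, d] j) ↔ _
    fin_cases i <;> fin_cases j <;> simp_all [SimpleGraph.pathGraph_adj]

/-- The path on four vertices is self-complementary: the complement of `a - b - c - d` is `c - a - d
- b`. -/
theorem NoInducedPath.not {r : V → V → Prop} (hr : ∀ x y, r x y → r y x) (h : NoInducedPath r) :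
    NoInducedPath fun x y => ¬ r x y := by
  intro a b c d hab hbc hcd hac had hbd
  by_contra! h'
  obtain ⟨h1, h2, h3⟩ := h'
  -- The negated relation need not be irreflexive, so consecutive vertices may coincide.
  by_cases hne : b = c ∨ a = b ∨ c = d
  · grind
  · push Not at hne
    rcases h c a d b (hr _ _ h1) h2 (hr _ _ h3) hne.2.2 hne.1.symm hne.2.1 with h | h | h
    exacts [hcd h, hbc (hr _ _ h), hab h]

/-- Either no vertex of `A` is `r`-related to one of `B`, or every one is. -/
def Homogeneous (r : V → V → Prop) (A B : Finset V) : Prop :=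
  (∀ x ∈ A, ∀ y ∈ B, ¬ r x y) ∨ ∀ x ∈ A, ∀ y ∈ B, r x y

variable [DecidableEq V]

/-- The inductive step of the decomposition of cographs: a new vertex is added to a set with no
edges between its parts `A` and `B`. -/
theorem exists_homogeneous_insert {r : V → V → Prop} (hsymm : ∀ x y, r x y → r y x)
    (h : NoInducedPath r) {A B : Finset V} (hA : A.Nonempty) (hB : B.Nonempty) {v : V}
    (hvA : v ∉ A) (hvB : v ∉ B) (hAB : Disjoint A B) (hr : ∀ x ∈ A, ∀ y ∈ B, ¬ r x y) :
    ∃ A' B', A'.Nonempty ∧ B'.Nonempty ∧ Disjoint A' B' ∧ A' ∪ B' = insert v (A ∪ B) ∧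
      Homogeneous r A' B' := by
  classical
  by_cases hall : ∀ w ∈ A ∪ B, r v w
  · exact ⟨{v}, A ∪ B, by simp, by simp [hA], by simp [hvA, hvB], (Finset.insert_eq _ _).symm,
      .inr (by simpa using hall)⟩
  wlog hw : ∃ w ∈ A, ¬ r v w generalizing A B
  · push Not at hall
    obtain ⟨w, hwAB, hwv⟩ := hall
    have hwB : w ∈ B := (Finset.mem_union.1 hwAB).resolve_left fun hwA => hw ⟨w, hwA, hwv⟩
    obtain ⟨A', B', h1, h2, h3, h4, h5⟩ := this hB hA hvB hvA hAB.symm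
      (fun x hx y hy hxy => hr y hy x hx (hsymm _ _ hxy))
      (fun hall => hwv (hall w (by simp [hwB]))) ⟨w, hwB, hwv⟩
    exact ⟨A', B', h1, h2, h3, by rw [h4, Finset.union_comm], h5⟩
  obtain ⟨w, hwA, hwv⟩ := hw
  by_cases hvB' : ∃ z ∈ B, r v z
  · obtain ⟨z, hzB, hvz⟩ := hvB'
    -- The part split off is the component of `w` inside `A`; it remains to see that `v` has no
    -- neighbour in it.
    set C := A.filter fun x => Relation.ReflTransGen (fun a b => b ∈ A ∧ r a b) w x with hC
    have hCA : C ⊆ A := Finset.filter_subset _ _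
    have hwC : w ∈ C := by simp [hC, hwA, Relation.ReflTransGen.refl]
    have hCv : ∀ x ∈ C, ¬ r v x := by
      intro x hx
      have hx' := (Finset.mem_filter.1 hx).2
      have : x ∈ A ∧ ¬ r v x := by
        clear hx
        induction hx' with
        | refl => exact ⟨hwA, hwv⟩
        | @tail y x _ hyx ih =>
          refine ⟨hyx.1, fun hvx => ?_⟩
          -- At the first neighbour `x` of `v` along a walk from `w`, with predecessor `y`, the
          -- vertices `z - v - x - y` would form an induced path.
          rcases h z v x y (hsymm _ _ hvz) hvx (hsymm _ _ hyx.2)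
            (by rintro rfl; exact Finset.disjoint_left.1 hAB hyx.1 hzB)
            (by rintro rfl; exact Finset.disjoint_left.1 hAB ih.1 hzB)
            (by rintro rfl; exact hvA ih.1) with h | h | h
          · exact hr _ hyx.1 _ hzB (hsymm _ _ h)
          · exact hr _ ih.1 _ hzB (hsymm _ _ h)
          · exact ih.2 h
      exact this.2
    refine ⟨C, insert v (A ∪ B) \ C, ⟨w, hwC⟩, ⟨v, ?_⟩, Finset.disjoint_sdiff, ?_, .inl ?_⟩
    · simpa using fun h => hvA (hCA h)
    · rw [Finset.union_sdiff_of_subset]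
      exact hCA.trans (Finset.subset_union_left.trans (Finset.subset_insert _ _))
    · intro x hx y hy hxy
      obtain ⟨hy1, hy2⟩ := Finset.mem_sdiff.1 hy
      rcases Finset.mem_insert.1 hy1 with rfl | hy1
      · exact hCv x hx (hsymm _ _ hxy)
      rcases Finset.mem_union.1 hy1 with hy1 | hy1
      · exact hy2 (Finset.mem_filter.2 ⟨hy1, (Finset.mem_filter.1 hx).2.tail ⟨hy1, hxy⟩⟩)
      · exact hr x (hCA hx) y hy1 hxy
  · push Not at hvB'
    refine ⟨insert v A, B, by simp, hB, by simp [hvB, hAB], by simp, .inl ?_⟩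
    intro x hx y hy
    rcases Finset.mem_insert.1 hx with rfl | hx
    exacts [hvB' y hy, hr x hx y hy]

theorem NoInducedPath.exists_homogeneous {r : V → V → Prop} (hsymm : ∀ x y, r x y → r y x)
    (h : NoInducedPath r) (s : Finset V) (hs : 1 < s.card) :
    ∃ A B, A.Nonempty ∧ B.Nonempty ∧ Disjoint A B ∧ A ∪ B = s ∧ Homogeneous r A B := by
  induction s using Finset.induction_on with
  | empty => simp at hs
  | insert v s hv ih =>
    by_cases hs1 : 1 < s.card
    · obtain ⟨A, B, hA, hB, hAB, rfl, hr | hr⟩ := ih hs1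
      all_goals
        simp only [Finset.mem_union, not_or] at hv
      · exact exists_homogeneous_insert hsymm h hA hB hv.1 hv.2 hAB hr
      -- If the two parts are completely joined, the insertion step is applied to the complement.
      · obtain ⟨A', B', h1, h2, h3, h4, h5⟩ := exists_homogeneous_insert
          (fun x y hxy hyx => hxy (hsymm _ _ hyx)) (h.not hsymm) hA hB hv.1 hv.2 hAB
          fun x hx y hy hn => hn (hr x hx y hy)
        refine ⟨A', B', h1, h2, h3, h4, ?_⟩
        rcases h5 with h5 | h5
        · exact .inr fun x hx y hy => not_not.1 (h5 x hx y hy)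
        · exact .inl h5
    · rw [Finset.card_insert_of_notMem hv] at hs
      obtain ⟨w, rfl⟩ := Finset.card_eq_one.1 (show s.card = 1 by omega)
      refine ⟨{v}, {w}, by simp, by simp, by simpa using hv, rfl, ?_⟩
      by_cases hvw : r v w
      · exact .inr (by simpa using hvw)
      · exact .inl (by simpa using hvw)

end Seinsche

/-! ### Graphs of cotrees, correctness of the computation, and the induction. -/

namespace Cotree

/-- The vertices of the graph of a cotree. -/
def Vert : Cotree → Type
  | leaf => Unit
  | node _ s t => s.Vert ⊕ t.Vert

/-- The graph described by a cotree. -/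
def graph : (t : Cotree) → SimpleGraph t.Vert
  | leaf => (⊥ : SimpleGraph Unit)
  | node c s t => combineGraphs c s.graph t.graph

theorem nonempty_vert (t : Cotree) : Nonempty t.Vert := by
  induction t with
  | leaf => exact ⟨()⟩
  | node c s t ihs _ => exact ihs.map .inl

theorem isIndContained_of_mem_splits {c : Bool} {F : Cotree} {x : Cotree × Cotree}
    (hx : x ∈ splits c F) : F.graph ⊴ combineGraphs c x.1.graph x.2.graph := by
  induction F generalizing x with
  | leaf => simp [splits] at hx
  | node d s t ihs iht =>
    by_cases hcd : c = d
    · subst hcd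
      simp only [splits, beq_self_eq_true, cond_true, List.mem_cons, List.mem_append,
        List.mem_flatMap, List.mem_map, List.not_mem_nil, or_false] at hx
      have hs : ∀ y ∈ splits c s, (node c s t).graph ⊴
          combineGraphs c (combineGraphs c y.1.graph y.2.graph) t.graph := fun y hy =>
        isIndContained_combineGraphs c (ihs hy) .rfl
      have ht : ∀ y ∈ splits c t, (node c s t).graph ⊴
          combineGraphs c s.graph (combineGraphs c y.1.graph y.2.graph) := fun y hy =>
        isIndContained_combineGraphs c .rfl (iht hy)
      rcases hx with rfl | rfl | ⟨y, hy, rfl | rfl | ⟨z, hz, rfl⟩⟩ | ⟨y, hy, rfl | rfl⟩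
      · exact .rfl
      · exact isIndContained_combineGraphs_comm c _ _
      · exact (hs y hy).trans (isIndContained_combineGraphs_right_comm c _ _ _)
      · exact (hs y hy).trans (isIndContained_combineGraphs_assoc c _ _ _)
      · exact (isIndContained_combineGraphs c (ihs hy) (iht hz)).trans
          (isIndContained_combineGraphs_interchange c _ _ _ _)
      · exact (ht y hy).trans (isIndContained_combineGraphs_assoc_symm c _ _ _)
      · exact (ht y hy).trans <| (isIndContained_combineGraphs_assoc_symm c _ _ _).trans <|
          (isIndContained_combineGraphs_right_comm c _ _ _).trans <|
            isIndContained_combineGraphs_comm c _ _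
    · simp [splits, beq_false_of_ne hcd] at hx

/-- Only soundness of the test is needed: the finite check uses positive answers alone. -/
theorem isIndContained_of_embeds {F t : Cotree} (h : embeds F t = true) : F.graph ⊴ t.graph := by
  induction t generalizing F with
  | leaf =>
    cases F with
    | leaf => exact .rfl
    | node => simp [embeds] at h
  | node c s t ihs iht =>
    simp only [embeds, Bool.or_eq_true, List.any_eq_true, Bool.and_eq_true] at h
    rcases h with (h | h) | ⟨x, hx, h1, h2⟩
    · exact (ihs h).trans (isIndContained_combineGraphs_left c _ _)
    · exact (iht h).trans (isIndContained_combineGraphs_right c _ _)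
    · exact (isIndContained_of_mem_splits hx).trans
        (isIndContained_combineGraphs c (ihs h1) (iht h2))

/-- Working with vertex sets inside the fixed graph `G` lets strong induction run without passing to
induced subgraphs; homogeneity of the two parts supplies the label of the root. -/
theorem exists_graph_of_isCograph {V : Type*} {G : SimpleGraph V} (hG : IsCograph G)
    (s : Finset V) (hs : s.Nonempty) :
    ∃ (t : Cotree) (f : t.Vert → V), f.Injective ∧ (∀ v, v ∈ s ↔ ∃ x, f x = v) ∧
      ∀ x y, G.Adj (f x) (f y) ↔ t.graph.Adj x y := by
  classical
  induction s using Finset.strongInduction with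
  | H s ih =>
    by_cases hs1 : 1 < s.card
    · obtain ⟨A, B, hA, hB, hAB, rfl, hr⟩ :=
        hG.noInducedPath.exists_homogeneous (fun _ _ h => h.symm) s hs1
      have hAs : A ⊂ A ∪ B := by
        refine Finset.subset_union_left.ssubset_of_ne fun h => ?_
        obtain ⟨b, hb⟩ := hB
        exact Finset.disjoint_right.1 hAB hb (h ▸ Finset.mem_union_right A hb)
      have hBs : B ⊂ A ∪ B := by
        refine Finset.subset_union_right.ssubset_of_ne fun h => ?_
        obtain ⟨a, ha⟩ := hA
        exact Finset.disjoint_left.1 hAB ha (h ▸ Finset.mem_union_left B ha)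
      obtain ⟨t, f, hf, hft, hfa⟩ := ih A hAs hA
      obtain ⟨u, g, hg, hgu, hga⟩ := ih B hBs hB
      have hfA : ∀ x, f x ∈ A := fun x => (hft _).2 ⟨x, rfl⟩
      have hgB : ∀ x, g x ∈ B := fun x => (hgu _).2 ⟨x, rfl⟩
      obtain ⟨c, hc⟩ : ∃ c : Bool, ∀ x ∈ A, ∀ y ∈ B, G.Adj x y ↔ c = true := by
        rcases hr with hr | hr
        · exact ⟨false, fun x hx y hy => by simpa using hr x hx y hy⟩
        · exact ⟨true, fun x hx y hy => by simpa using hr x hx y hy⟩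
      refine ⟨node c t u, Sum.elim f g, hf.sumElim hg fun x y h => ?_, fun v => ?_, ?_⟩
      · exact Finset.disjoint_left.1 hAB (hfA x) (h ▸ hgB y)
      · rw [Finset.mem_union, hft, hgu]
        exact (Sum.exists (p := fun x => Sum.elim f g x = v)).symm
      · rintro (x | x) (y | y)
        · exact (hfa x y).trans (combineGraphs_inl_inl c _ _ x y).symm
        · exact (hc _ (hfA x) _ (hgB y)).trans (combineGraphs_inl_inr c _ _ x y).symm
        · exact (G.adj_comm _ _).trans <| (hc _ (hfA y) _ (hgB x)).trans
            (combineGraphs_inr_inl c _ _ x y).symm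
        · exact (hga x y).trans (combineGraphs_inr_inr c _ _ x y).symm
    · obtain ⟨v, rfl⟩ := Finset.card_eq_one.1 (le_antisymm (not_lt.1 hs1) hs.card_pos)
      refine ⟨leaf, fun _ => v, fun _ _ _ => rfl, fun w => ?_, fun x y => ?_⟩
      · exact Finset.mem_singleton.trans ⟨fun h => ⟨(), h.symm⟩, fun ⟨_, h⟩ => h.symm⟩
      · exact iff_of_false G.irrefl id

theorem exists_iso_of_isCograph {V : Type*} [Finite V] [Nonempty V] {G : SimpleGraph V}
    (hG : IsCograph G) : ∃ t : Cotree, Nonempty (t.graph ≃g G) := by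
  classical
  have := Fintype.ofFinite V
  obtain ⟨t, f, hf, hs, hadj⟩ := exists_graph_of_isCograph hG Finset.univ Finset.univ_nonempty
  exact ⟨t, ⟨⟨Equiv.ofBijective f ⟨hf, fun v => (hs v).1 (Finset.mem_univ v)⟩, hadj _ _⟩⟩⟩

theorem hasLevels_leaf (x : Fin 3 × Fin 3) : HasLevels leaf.graph x ↔ x ∈ levels.tail := by
  have hadj : ∀ a b : leaf.Vert, ¬ leaf.graph.Adj a b := fun _ _ h => h
  have hA : ∀ i : Fin 3, i ≠ 0 → ∀ A, ClusterLevel leaf.graph A i := by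
    intro i hi A
    fin_cases i
    · exact absurd rfl hi
    · exact fun a b _ _ hab => absurd rfl hab
    · exact fun a b c _ _ _ hab => absurd hab (hadj a b)
  have hB : ∀ i : Fin 3, i ≠ 0 → ∀ B, TriangleFreeLevel leaf.graph B i := by
    intro i hi B
    fin_cases i
    · exact absurd rfl hi
    · exact fun a b _ _ => hadj a b
    · exact fun a b c _ _ _ hab => absurd hab (hadj a b)
  have hlevels : x ∈ levels.tail ↔ x ≠ (0, 0) := by
    revert x; decide
  rw [hlevels]
  constructor
  · rintro ⟨A, h1, h2⟩ rfl
    exact h2 () (h1 ())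
  · obtain ⟨i, j⟩ := x
    intro hx
    by_cases hi : i = 0
    · subst hi
      exact ⟨fun _ => False, fun _ h => h, hB j (fun h => hx (by rw [h])) _⟩
    · by_cases hj : j = 0
      · subst hj
        exact ⟨fun _ => True, hA i hi _, fun _ h => h trivial⟩
      · exact ⟨fun _ => True, hA i hi _, hB j hj _⟩

theorem hasLevels_node (c : Bool) (s t : Cotree) (x : Fin 3 × Fin 3) :
    HasLevels (node c s t).graph x ↔ ∃ a ∈ clusterSplits c x.1, ∃ b ∈ triangleFreeSplits c x.2,
      HasLevels s.graph (a.1, b.1) ∧ HasLevels t.graph (a.2, b.2) :=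
  hasLevels_combineGraphs c x

theorem mem_combine (c : Bool) (p q : List (Fin 3 × Fin 3)) (x : Fin 3 × Fin 3) :
    x ∈ combine c p q ↔ ∃ a ∈ clusterSplits c x.1, ∃ b ∈ triangleFreeSplits c x.2,
      (a.1, b.1) ∈ p ∧ (a.2, b.2) ∈ q := by
  have hx : x ∈ levels := by revert x; decide
  simp [combine, hx]

/-- Merging the nonpartitionable graphs loses nothing for partitionable ones: if a node is
partitionable, so are both children, and their states are then their full tables. -/
theorem state_spec (t : Cotree) :
    (∀ x, x ∈ state t ↔ HasLevels t.graph x ∧ HasLevels t.graph (2, 2)) := by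
  induction t with
  | leaf =>
    intro x
    rw [hasLevels_leaf, hasLevels_leaf, state]
    exact (and_iff_left (by decide)).symm
  | node c s t ihs iht =>
    have key : HasLevels (node c s t).graph (2, 2) →
        ∀ x, x ∈ combine c (state s) (state t) ↔ HasLevels (node c s t).graph x := by
      intro h x
      have hs := h.of_isIndContained (isIndContained_combineGraphs_left c s.graph t.graph)
      have ht := h.of_isIndContained (isIndContained_combineGraphs_right c s.graph t.graph)
      rw [mem_combine, hasLevels_node]
      simp only [ihs, iht, hs, ht, and_true]
    have key' : (2, 2) ∈ combine c (state s) (state t) → HasLevels (node c s t).graph (2, 2) := by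
      rw [mem_combine, hasLevels_node]
      simp only [ihs, iht]
      rintro ⟨a, ha, b, hb, h1, h2⟩
      exact ⟨a, ha, b, hb, h1.1, h2.1⟩
    intro x
    by_cases h : HasLevels (node c s t).graph (2, 2)
    · simp [state, (key h _).2 h, key h, h]
    · simp [state, mt key' h, h]

theorem hasLevels_iff_state_ne_nil (t : Cotree) : HasLevels t.graph (2, 2) ↔ state t ≠ [] := by
  constructor
  · intro h h0
    simpa [h0, h] using state_spec t (2, 2)
  · intro h
    obtain ⟨x, hx⟩ := List.exists_mem_of_ne_nil _ h
    exact ((state_spec t x).1 hx).2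

theorem state_node_eq_nil {c : Bool} {s t : Cotree} (h : state s = [] ∨ state t = []) :
    state (node c s t) = [] := by
  by_contra h0
  rw [← ne_eq, ← hasLevels_iff_state_ne_nil] at h0
  rcases h with h | h
  · exact (hasLevels_iff_state_ne_nil s).1
      (h0.of_isIndContained (isIndContained_combineGraphs_left c _ _)) h
  · exact (hasLevels_iff_state_ne_nil t).1
      (h0.of_isIndContained (isIndContained_combineGraphs_right c _ _)) h

theorem state_eq_of_mem_critical {D : List Cotree} (hD : D ∈ critical) {F : Cotree} (hF : F ∈ D) :
    state F = state (D.headD leaf) := by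
  rcases List.mem_cons.1 hD with rfl | hD
  · have h := state_forbidden
    simp only [List.all_eq_true, beq_iff_eq] at h
    rw [h F hF]
    exact (h (forbidden.headD leaf) (by simp [forbidden])).symm
  · have h := state_benign
    simp only [List.all_eq_true, Bool.and_eq_true, beq_iff_eq] at h
    exact (h D hD F hF).1

/-- Every cotree contains a critical one of the same state. -/
theorem exists_critical (t : Cotree) :
    ∃ D ∈ critical, ∃ F ∈ D, F.graph ⊴ t.graph ∧ state F = state t := by
  induction t with
  | leaf => exact ⟨[leaf], by simp [critical, benign], leaf, by simp, .rfl, rfl⟩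
  | node c s t ihs iht =>
    obtain ⟨C, hC, F, hF, hFs, hs⟩ := ihs
    obtain ⟨C', hC', F', hF', hFt, ht⟩ := iht
    -- A nonpartitionable child makes the node nonpartitionable, so the listed graph found in the
    -- child already serves.
    by_cases h : state s = []
    · exact ⟨C, hC, F, hF, hFs.trans (isIndContained_combineGraphs_left c _ _),
        by rw [hs, h, state_node_eq_nil (.inl h)]⟩
    by_cases h' : state t = []
    · exact ⟨C', hC', F', hF', hFt.trans (isIndContained_combineGraphs_right c _ _),
        by rw [ht, h', state_node_eq_nil (.inr h')]⟩
    have hb : ∀ {C : List Cotree} {F s : Cotree}, C ∈ critical → F ∈ C → state F = state s →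
        state s ≠ [] → C ∈ benign := by
      intro C F s hC hF hs h
      rcases List.mem_cons.1 hC with rfl | hC
      · have h0 := state_forbidden
        simp only [List.all_eq_true, beq_iff_eq] at h0
        exact absurd (hs ▸ h0 F hF) h
      · exact hC
    have hcl := critical_closed
    simp only [List.all_eq_true, List.any_eq_true, Bool.and_eq_true, beq_iff_eq] at hcl
    obtain ⟨D, hD, hst, hDe⟩ := hcl C (hb hC hF hs h) C' (hb hC' hF' ht h') c (by cases c <;> simp)
    obtain ⟨E, hE, hEe⟩ := hDe F hF F' hF'
    -- `E` embeds in the combination of `F` and `F'`, which embeds in the node.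
    refine ⟨D, hD, E, hE, (isIndContained_of_embeds hEe).trans
      (isIndContained_combineGraphs c hFs hFt), ?_⟩
    rw [state_eq_of_mem_critical hD hE, hst]
    simp only [state, ← state_eq_of_mem_critical hC hF, ← state_eq_of_mem_critical hC' hF', hs, ht]

theorem hasLevels_iff_forbidden (t : Cotree) :
    HasLevels t.graph (2, 2) ↔ ∀ F ∈ forbidden, ¬ F.graph ⊴ t.graph := by
  have h0 := state_forbidden
  simp only [List.all_eq_true, beq_iff_eq] at h0
  constructor
  · intro h F hF hFt
    exact (hasLevels_iff_state_ne_nil F).1 (h.of_isIndContained hFt) (h0 F hF)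
  · intro h
    rw [hasLevels_iff_state_ne_nil]
    intro ht
    obtain ⟨D, hD, F, hF, hFt, hs⟩ := exists_critical t
    rcases List.mem_cons.1 hD with rfl | hD
    · exact h F hF hFt
    · have hb := state_benign
      simp only [List.all_eq_true, Bool.and_eq_true, bne_iff_ne] at hb
      exact (hb D hD F hF).2 (hs.trans ht)

end Cotree

/-! ### Matching the seventeen graphs with their cotrees. -/

section Represents

open Cotree

variable {V W : Type*} {G : SimpleGraph V} {H : SimpleGraph W}

/-- The cotree `t` describes the graph `G` up to isomorphism. -/
def Represents (G : SimpleGraph V) (t : Cotree) : Prop :=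
  Nonempty (G ≃g t.graph)

theorem Represents.combineGraphs {s t : Cotree} (c : Bool) (hG : Represents G s)
    (hH : Represents H t) : Represents (combineGraphs c G H) (node c s t) := by
  obtain ⟨f⟩ := hG
  obtain ⟨g⟩ := hH
  refine ⟨⟨f.toEquiv.sumCongr g.toEquiv, ?_⟩⟩
  rintro (x | x) (y | y)
  · exact (combineGraphs_inl_inl c _ _ _ _).trans
      (f.map_adj_iff.trans (combineGraphs_inl_inl c _ _ _ _).symm)
  · exact (combineGraphs_inl_inr c _ _ _ _).trans (combineGraphs_inl_inr c _ _ _ _).symm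
  · exact (combineGraphs_inr_inl c _ _ _ _).trans (combineGraphs_inr_inl c _ _ _ _).symm
  · exact (combineGraphs_inr_inr c _ _ _ _).trans
      (g.map_adj_iff.trans (combineGraphs_inr_inr c _ _ _ _).symm)

theorem Represents.union {s t : Cotree} (hG : Represents G s) (hH : Represents H t) :
    Represents (G ⊕g H) (node false s t) :=
  hG.combineGraphs false hH

theorem Represents.join {s t : Cotree} (hG : Represents G s) (hH : Represents H t) :
    Represents (join G H) (node true s t) :=
  hG.combineGraphs true hH

theorem Represents.two {t : Cotree} (hG : Represents G t) :
    Represents (two G) (node false t t) :=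
  hG.union hG

theorem Represents.of_iso {t : Cotree} (hG : Represents G t) (f : H ≃g G) : Represents H t :=
  hG.map f.trans

theorem Represents.isIndContained_iff {t : Cotree} (hG : Represents G t) :
    G ⊴ H ↔ t.graph ⊴ H := by
  obtain ⟨f⟩ := hG
  exact ⟨fun h => .trans ⟨f.symm.toEmbedding⟩ h, fun h => .trans ⟨f.toEmbedding⟩ h⟩

theorem represents_K_one : Represents (K 1) leaf :=
  ⟨⟨(Equiv.equivPUnit (Fin 1)).trans (Equiv.refl Unit), fun {a b} =>
    iff_of_false id fun h => h.ne (Subsingleton.elim a b)⟩⟩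

theorem represents_K_succ {n : ℕ} {t : Cotree} (h : Represents (K n) t) :
    Represents (K (n + 1)) (node true t leaf) := by
  refine (h.join represents_K_one).of_iso ⟨finSumFinEquiv.symm, ?_⟩
  intro a b
  obtain ⟨a, rfl⟩ := finSumFinEquiv.surjective a
  obtain ⟨b, rfl⟩ := finSumFinEquiv.surjective b
  rcases a with a | a <;> rcases b with b | b <;>
    simp [CographPartition.join, K, Fin.ext_iff] <;> omega

theorem represents_K_two : Represents (K 2) (node true leaf leaf) :=
  represents_K_succ represents_K_one

theorem represents_K_three : Represents (K 3) (node true (node true leaf leaf) leaf) :=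
  represents_K_succ represents_K_two

theorem represents_two_K_one : Represents (CographPartition.two (K 1)) (node false leaf leaf) :=
  represents_K_one.two

theorem represents_P_three : Represents (P 3) (node true leaf (node false leaf leaf)) := by
  refine (represents_K_one.join represents_two_K_one).of_iso
    -- The middle vertex `1` is the single vertex of the join; the ends `0` and `2` form the
    -- independent pair.
    ⟨⟨![.inr (.inl 0), .inl 0, .inr (.inr 0)], Sum.elim ![1] (Sum.elim ![0] ![2]), ?_, ?_⟩, ?_⟩
  · intro a
    fin_cases a <;> rfl
  · rintro (a | a | a) <;> fin_cases a <;> rfl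
  · intro a b
    fin_cases a <;> fin_cases b <;>
      simp [CographPartition.join, CographPartition.two, P, K, SimpleGraph.pathGraph_adj]

theorem represents_C_four :
    Represents (C 4) (node true (node false leaf leaf) (node false leaf leaf)) := by
  refine (represents_two_K_one.join represents_two_K_one).of_iso
    -- The two independent pairs are the opposite vertices `0, 2` and `1, 3`.
    ⟨⟨![.inl (.inl 0), .inr (.inl 0), .inl (.inr 0), .inr (.inr 0)],
      Sum.elim (Sum.elim ![0] ![2]) (Sum.elim ![1] ![3]), ?_, ?_⟩, ?_⟩
  · intro a
    fin_cases a <;> rfl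
  · rintro ((a | a) | a | a) <;> fin_cases a <;> rfl
  · intro a b
    fin_cases a <;> fin_cases b <;>
      simp [CographPartition.join, CographPartition.two, C, K, SimpleGraph.cycleGraph_adj] <;> decide

theorem forall_forbidden_iff (G : SimpleGraph V) :
    (∀ F ∈ forbidden, ¬ F.graph ⊴ G) ↔
      ¬ H1 ⊴ G ∧ ¬ H2 ⊴ G ∧ ¬ H3 ⊴ G ∧ ¬ H4 ⊴ G ∧ ¬ H5 ⊴ G ∧ ¬ H6 ⊴ G ∧ ¬ H7 ⊴ G ∧
      ¬ H8 ⊴ G ∧ ¬ H9 ⊴ G ∧ ¬ H10 ⊴ G ∧ ¬ H11 ⊴ G ∧ ¬ H12 ⊴ G ∧ ¬ H13 ⊴ G ∧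
      ¬ H14 ⊴ G ∧ ¬ H15 ⊴ G ∧ ¬ H16 ⊴ G ∧ ¬ H17 ⊴ G := by
  have k1 := represents_K_one
  have k2 := represents_K_two
  have k3 := represents_K_three
  have p3 := represents_P_three
  have paw := k1.join (k2.union k1)
  simp only [forbidden, List.forall_mem_cons, List.not_mem_nil, false_implies, implies_true,
    and_true]
  rw [H1, (((k1.two.join k1.two).join k1.two).join k1).isIndContained_iff,
    H2, ((p3.join k1).join k2.two).isIndContained_iff,
    H3, ((k1.two.join (k2.union k1)).join (k2.union k1)).isIndContained_iff,
    H4, (p3.join (k2.union p3)).isIndContained_iff,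
    H5, (((k2.union k1).join k1).join k2.two).isIndContained_iff,
    H6, ((k2.union k1).join (k3.union p3)).isIndContained_iff,
    H7, ((k2.union k1).join (k2.union (p3.join k1))).isIndContained_iff,
    H8, ((k2.union k1).join (k2.union paw)).isIndContained_iff,
    H9, (k1.join (k3.union (represents_C_four.join k1))).isIndContained_iff,
    H10, (k1.join (k3.union (k1.join (p3.union k2)))).isIndContained_iff,
    H11, (k1.join (k3.union (k2.join k2.two))).isIndContained_iff,
    H12, (k1.join (k3.union ((k2.union k1).join (k2.union k1)))).isIndContained_iff,
    H13, (k2.join (p3.union k3.two)).isIndContained_iff,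
    H14, (k2.join (k3.union (p3.join k1))).isIndContained_iff,
    H15, (k2.join (k3.union (k1.join (k1.union k2)))).isIndContained_iff,
    H16, ((k3.union k2).join (k3.union k1)).isIndContained_iff,
    H17, (k3.join k3.two).isIndContained_iff]

end Represents

end CographPartition

open CographPartition in
theorem theorem2 {V : Type*} [Finite V] (G : SimpleGraph V) (hG : IsCograph G) :
    IsPartitionable G ↔
      ¬ H1 ⊴ G ∧ ¬ H2 ⊴ G ∧ ¬ H3 ⊴ G ∧ ¬ H4 ⊴ G ∧ ¬ H5 ⊴ G ∧ ¬ H6 ⊴ G ∧ ¬ H7 ⊴ G ∧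
      ¬ H8 ⊴ G ∧ ¬ H9 ⊴ G ∧ ¬ H10 ⊴ G ∧ ¬ H11 ⊴ G ∧ ¬ H12 ⊴ G ∧ ¬ H13 ⊴ G ∧
      ¬ H14 ⊴ G ∧ ¬ H15 ⊴ G ∧ ¬ H16 ⊴ G ∧ ¬ H17 ⊴ G := by
  rw [← forall_forbidden_iff, isPartitionable_iff_hasLevels]
  rcases isEmpty_or_nonempty V with hV | hV
  -- No cotree describes the empty graph; it is trivially partitionable, and every forbidden graph
  -- has a vertex.
  · refine iff_of_true ⟨fun _ => True, ?_, ?_⟩ ?_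
    · exact fun x => hV.elim x
    · exact fun x => hV.elim x
    · rintro F - ⟨f⟩
      exact hV.elim (f F.nonempty_vert.some)
  · obtain ⟨t, ⟨f⟩⟩ := Cotree.exists_iso_of_isCograph hG
    have hGt : G ⊴ t.graph := ⟨f.symm.toEmbedding⟩
    have htG : t.graph ⊴ G := ⟨f.toEmbedding⟩
    have key := Cotree.hasLevels_iff_forbidden t
    exact ⟨fun h F hF hFG => key.1 (h.of_isIndContained htG) F hF (hFG.trans hGt),
      fun h => (key.2 fun F hF hFt => h F hF (hFt.trans htG)).of_isIndContained hGt⟩
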